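/- Consider a single-server FCFS queue with Poisson($\lambda$) potential arrivals, $\lambda>0$, in which the service rate is $\mu_n=\mu_l$ when the number $n$ of customers in the system satisfies $n\le T$ and $\mu_n=\mu_h$ when $n>T$, where $T\ge 1$ is an integer and $0<\mu_l<\mu_h$. Every customer who joins receives a reward $R\ge 0$ and pays a waiting cost $C>0$ per unit of time in the system; put $\tilde R=R/C$. A joining strategy is a sequence $p=(p_n)_{n\ge 0}\in[0,1]^{\mathbb N}$, where $p_n$ is the probability of joining when $n$ customers are found upon arrival. For $n<m$ let $W(n,m;p)$ be the expected remaining sojourn time of a tagged customer with $n$ customers in front of her and $m$ customers in total in the system, when all future arrivals follow $p$: it is the expected absorption time of the continuous-time Markov chain that moves from $(n,m)$ to $(n,m+1)$ at rate $\lambda p_m$ and, at rate $\mu_m$, to $(n-1,m-1)$ if $n\ge 1$ and to absorption if $n=0$. A customer who finds $n$ customers and follows $q$, while all others follow $p$, has expected net benefit $U_n(q;p)=q_n\,[R-C\,W(n,n+1;p)]$. A strategy $p$ with $n_0(p)=\min\{n:p_n=0\}<\infty$ is called an equilibrium (in the recurrent class) if $U_n(p;p)\ge U_n(q;p)$ for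 all strategies $q$ and all $n\le n_0(p)$. For an integer $n_0\ge 0$ let $\tilde p(n_0)$ be the pure threshold strategy with $\tilde p_n=1$ for $n<n_0$ and $\tilde p_n=0$ for $n\ge n_0$; we say that $n_0$ is an equilibrium threshold if $\tilde p(n_0)$ is an equilibrium. All the expected sojourn times $W(n,n+1;\tilde p(n_0))$, $n\le n_0$, are finite, and the following hold. (i) In the range $\{0,1,\ldots,T\}$ there are at most two equilibrium thresholds. More precisely: (a) if $\tilde R\mu_l\le T$, $\tilde R\mu_l\in\mathbb Z$ and $R>0$, then there are exactly two equilibrium thresholds in $\{0,\ldots,T\}$, namely $\tilde R\mu_l-1$ and $\tilde R\mu_l$; if $R=0$, then $0$ is the only one; (b) if $\tilde R\mu_l<T$ and $\tilde R\mu_l\notin\mathbb Z$, then $\lfloor\tilde R\mu_l\rfloor$ is the unique equilibrium threshold in $\{0,\ldots,T\}$; (c) if $T<\tilde R\mu_l\le T+\frac{\mu_l}{\mu_h}$, then $T=\lfloor\tilde R\mu_l\rfloor$ is the unique equilibrium threshold in $\{0,\ldots,T\}$; (d) if $\tilde R\mu_l>T+\frac{\mu_l}{\mu_h}$, then there is no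 equilibrium threshold in $\{0,\ldots,T\}$. (ii) For every integer $n_0\ge T+1$, $\tilde p(n_0)$ is an equilibrium if and only if $$L\le n_0\le U\quad\text{and}\quad \tilde R-\frac1{\mu_h}\le W\bigl(n_0-1,n_0;\tilde p(n_0)\bigr)\le\tilde R,$$ where $L=\max\{(\tilde R-\frac1{\mu_h})\mu_l,\,T+1\}$ and $U=\max\{\tilde R\mu_h,\,T+1\}$. -/

import Mathlib

open MeasureTheory ProbabilityTheory
open scoped ENNReal

namespace ObservableQueue

/-- The mixed joining strategies `p = (p₀, p₁, …)`: a customer who finds `n` customers in the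
system upon arrival joins with probability `p n ∈ [0, 1]`. -/
def strategies : Set (ℕ → ℝ) := {p | ∀ n, 0 ≤ p n ∧ p n ≤ 1}

/-- The pure threshold strategy with threshold `n₀`: join if and only if at most `n₀ - 1`
customers are found in the system. -/
def thresholdStrategy (n₀ : ℕ) : ℕ → ℝ := fun n => if n < n₀ then 1 else 0

/-- The service rates of the two-rate threshold service policy `(T, μl, μh)`: `μl` when at most
`T` customers are in the system and `μh` when there are more. -/
def twoRate (T : ℕ) (μl μh : ℝ) : ℕ → ℝ := fun n => if n ≤ T then μl else μh

/-- A state of the Markov chain of a tagged customer: `some (n, m)` if there are `n` customers in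
front of her and `m` customers in total (herself included), `none` after her departure. -/
abbrev TaggedState : Type := Option (ℕ × ℕ)

/-- The driving noise: for each transition a uniform variable on `[0, 1]`, which selects the type
of the transition, and a unit exponential variable, which gives the holding time. -/
abbrev Noise : Type := ℕ → unitInterval × ℝ

/-- The law of the noise of one transition. -/
noncomputable def stepLaw : Measure (unitInterval × ℝ) :=
  (volume : Measure unitInterval).prod (expMeasure 1)

instance : IsProbabilityMeasure stepLaw := by
  have := isProbabilityMeasure_expMeasure (r := 1) one_pos
  unfold stepLaw
  infer_instance

/-- The law of the noise: independent, identically distributed copies over all transitions. -/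
noncomputable def noiseLaw : Measure Noise := Measure.infinitePi fun _ => stepLaw

/-- One transition of the tagged customer's chain, when potential customers arrive at rate `lam`,
future arrivals follow `p`, and the service rates are `μ`. In state `(n, m)` the arrival of a
joining customer has rate `lam * p m` and a service completion has rate `μ m`, so that the
next event is an arrival with probability `lam * p m / (lam * p m + μ m)`. Service is first come,
first served: an arrival leads to `(n, m + 1)`, a service completion to `(n - 1, m - 1)` if
`n ≥ 1` and to the departure of the tagged customer if `n = 0`. -/
noncomputable def nextState (lam : ℝ) (μ p : ℕ → ℝ) (u : unitInterval) :
    TaggedState → TaggedState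
  | none => none
  | some (n, m) =>
      if (u : ℝ) < lam * p m / (lam * p m + μ m) then some (n, m + 1)
      else if n = 0 then none
      else some (n - 1, m - 1)

/-- The holding time: in state `(n, m)` it is exponential with rate `lam * p m + μ m`, obtained
by scaling a unit exponential variable `e`. No time is counted after the departure. -/
noncomputable def holdingTime (lam : ℝ) (μ p : ℕ → ℝ) (e : ℝ) : TaggedState → ℝ
  | none => 0
  | some (_, m) => e / (lam * p m + μ m)

/-- The state of the tagged customer after `k` transitions, started from `s`. -/
noncomputable def stateAfter (lam : ℝ) (μ p : ℕ → ℝ) (s : TaggedState) (ω : Noise) :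
    ℕ → TaggedState
  | 0 => s
  | k + 1 => nextState lam μ p (ω k).1 (stateAfter lam μ p s ω k)

/-- The remaining sojourn time of the tagged customer, started from `s`. -/
noncomputable def sojournTime (lam : ℝ) (μ p : ℕ → ℝ) (s : TaggedState) (ω : Noise) : ℝ≥0∞ :=
  ∑' k, ENNReal.ofReal (holdingTime lam μ p (ω k).2 (stateAfter lam μ p s ω k))

/-- The expected remaining sojourn time, with values in `[0, ∞]`, of a tagged customer with `n`
customers in front of her and `m` customers in total, when all future arrivals follow `p`. -/
noncomputable def expectedSojourn (lam : ℝ) (μ p : ℕ → ℝ) (n m : ℕ) : ℝ≥0∞ :=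
  ∫⁻ ω, sojournTime lam μ p (some (n, m)) ω ∂noiseLaw

/-- The generalized waiting time `W(n, m; p)`, as a real number. -/
noncomputable def W (lam : ℝ) (μ p : ℕ → ℝ) (n m : ℕ) : ℝ :=
  (expectedSojourn lam μ p n m).toReal

/-- The delay `W(n; p)`: the expected sojourn time of a customer who finds `n` customers upon
arrival and joins (whatever `p` prescribes in state `n`), while all others follow `p`. -/
noncomputable def delay (lam : ℝ) (μ p : ℕ → ℝ) (n : ℕ) : ℝ := W lam μ p n (n + 1)

/-- The expected net benefit `U_n(q; p)` of a customer who finds `n` customers upon arrival and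
follows `q`, while all others follow `p`; `R` is the reward and `C` the waiting cost rate. -/
noncomputable def netBenefit (R C lam : ℝ) (μ q p : ℕ → ℝ) (n : ℕ) : ℝ :=
  q n * (R - C * delay lam μ p n)

/-- `p` is a symmetric equilibrium in the recurrent class: `p` is a mixed strategy that prescribes
balking in some state, and, `n₀` being the first such state, `p` is a best response against itself
in each of the recurrent states `0, 1, …, n₀`. -/
def IsEquilibrium (R C lam : ℝ) (μ p : ℕ → ℝ) : Prop :=
  p ∈ strategies ∧ ∃ n₀, IsLeast {n | p n = 0} n₀ ∧
    ∀ n ≤ n₀, ∀ q ∈ strategies, netBenefit R C lam μ q p n ≤ netBenefit R C lam μ p p n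

/-- The thresholds in `{0, 1, …, T}` whose pure threshold strategies are equilibria. -/
def lowEquilibria (R C lam : ℝ) (μ : ℕ → ℝ) (T : ℕ) : Set ℕ :=
  {n₀ | n₀ ≤ T ∧ IsEquilibrium R C lam μ (thresholdStrategy n₀)}

end ObservableQueue

open ObservableQueue

/-! A threshold strategy is an equilibrium exactly when the delay is at most `R / C` in every state
below the threshold and at least `R / C` at the threshold. Everything thus reduces to the numbers
`W`, which obey a linear first-step recursion (`meanSojourn_some`, `W_threshold_rec`). Arrivals stop
at the threshold and services reduce `n`, so the tagged chain has no cycles and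
`threshold_induction` proves finiteness and comparisons from that recursion alone.

For a threshold `N ≤ T`, a customer joining at `n < T` is always served at rate `μl`, so her delay
is `(n + 1) / μl`; only the one who joins at `N = T` has a first service at rate `μh`, whence the
term `μl / μh`. Part (i) is then arithmetic around the floor of `R / C * μl`.

For `N > T`, delays increase below the threshold (`delay_threshold_mono`), so only the states `N -
1` and `N` matter, and their delays differ by a service of mean `1 / μh`. The bounds `L` and `U`
follow from `n₀ / μh ≤ W (n₀ - 1) n₀ ≤ n₀ / μl`. -/

namespace ObservableQueue

/-! ### Splitting an i.i.d. sequence; exponential means -/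

/-- Prepend an element to a sequence. -/
def consSeq {X : Type*} (q : X × (ℕ → X)) : ℕ → X
  | 0 => q.1
  | k + 1 => q.2 k

lemma measurable_consSeq {X : Type*} [MeasurableSpace X] :
    Measurable (consSeq : X × (ℕ → X) → ℕ → X) := by
  refine measurable_pi_lambda _ fun k => ?_
  cases k with
  | zero => exact measurable_fst
  | succ k => exact (measurable_pi_apply k).comp measurable_snd

/-- An i.i.d. sequence is its first term followed by an independent copy of itself. -/
lemma map_consSeq_prod_infinitePi {X : Type*} [MeasurableSpace X] (ν : Measure X)
    [IsProbabilityMeasure ν] :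
    (ν.prod (Measure.infinitePi fun _ : ℕ => ν)).map consSeq = Measure.infinitePi fun _ : ℕ => ν := by
  classical
  refine Measure.eq_infinitePi (μ := fun _ : ℕ => ν) fun s t ht => ?_
  -- Enlarging `s` to an initial segment, with `univ` in the new coordinates, makes the preimage
  -- under `consSeq` a rectangle.
  obtain ⟨N, hN⟩ : ∃ N, s ⊆ Finset.range (N + 1) :=
    ⟨s.sup id, fun i hi => Finset.mem_range.2 (Nat.lt_succ_of_le (Finset.le_sup (f := id) hi))⟩
  set t' : ℕ → Set X := fun i => if i ∈ s then t i else Set.univ with ht'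
  have mt' : ∀ i, MeasurableSet (t' i) := fun i => by
    by_cases hi : i ∈ s <;> simp [ht', hi, ht]
  have hset : Set.pi (s : Set ℕ) t = Set.pi (Finset.range (N + 1) : Set ℕ) t' := by
    ext ω
    simp only [Set.mem_pi, Finset.mem_coe]
    constructor
    · intro h i _
      by_cases hi : i ∈ s <;> simp [ht', hi, h]
    · intro h i hi
      simpa [ht', hi] using h i (hN hi)
  have hprod : ∏ i ∈ s, ν (t i) = ∏ i ∈ Finset.range (N + 1), ν (t' i) := by
    rw [← Finset.prod_subset hN (f := fun i => ν (t' i))]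
    · exact Finset.prod_congr rfl fun i hi => by simp [ht', hi]
    · intro i _ hi
      simp [ht', hi]
  have hpre : consSeq ⁻¹' (Set.pi (Finset.range (N + 1) : Set ℕ) t') =
      t' 0 ×ˢ Set.pi (Finset.range N : Set ℕ) (fun i => t' (i + 1)) := by
    ext q
    simp only [Set.mem_preimage, Set.mem_pi, Finset.mem_coe, Finset.mem_range, Set.mem_prod]
    constructor
    · exact fun h => ⟨h 0 (by omega), fun i hi => h (i + 1) (by omega)⟩
    · rintro ⟨h0, h1⟩ (_ | i) hi
      · exact h0
      · exact h1 i (by omega)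
  rw [hset, hprod, Measure.map_apply measurable_consSeq
    (MeasurableSet.pi (Finset.countable_toSet _) fun i _ => mt' i), hpre, Measure.prod_prod,
    Measure.infinitePi_pi _ (fun i _ => mt' (i + 1)), Finset.prod_range_succ', mul_comm]

lemma lintegral_ofReal_expMeasure_one : ∫⁻ e, ENNReal.ofReal e ∂(expMeasure 1) = 1 := by
  have hm : Measurable (gammaPDF 1 1) := (measurable_gammaPDFReal 1 1).ennreal_ofReal
  rw [expMeasure, gammaMeasure, lintegral_withDensity_eq_lintegral_mul _ hm
    ENNReal.measurable_ofReal,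
    -- The integrand `e * exp (-e)` is the Gamma(2, 1) density, so its total mass is the required
    -- mean.
    ← lintegral_gammaPDF_eq_one (a := 2) (r := 1) two_pos one_pos]
  refine lintegral_congr fun x => ?_
  rcases lt_or_ge x 0 with hx | hx
  · simp [gammaPDF_of_neg hx]
  · rw [Pi.mul_apply, gammaPDF_of_nonneg hx, gammaPDF_of_nonneg hx,
      ← ENNReal.ofReal_mul (by simp; positivity)]
    congr 1
    norm_num [Real.Gamma_two]
    ring

lemma lintegral_ofReal_div_expMeasure_one {r : ℝ} (hr : 0 < r) :
    ∫⁻ e, ENNReal.ofReal (e / r) ∂(expMeasure 1) = ENNReal.ofReal (1 / r) := by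
  have h (e : ℝ) : ENNReal.ofReal (e / r) = ENNReal.ofReal e * ENNReal.ofReal (1 / r) := by
    rw [div_eq_mul_one_div, ENNReal.ofReal_mul' (one_div_pos.2 hr).le]
  rw [lintegral_congr h, lintegral_mul_const _ ENNReal.measurable_ofReal, lintegral_ofReal_expMeasure_one,
    one_mul]

/-! ### First-step analysis of the tagged chain -/

section FirstStep

variable (lam : ℝ) (μ p : ℕ → ℝ)

/-- The definition peels off the last transition; first-step analysis needs the first one peeled
off, with the noise shifted. -/
lemma stateAfter_succ_eq (s : TaggedState) (ω : Noise) (k : ℕ) :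
    stateAfter lam μ p s ω (k + 1) =
      stateAfter lam μ p (nextState lam μ p (ω 0).1 s) (fun i => ω (i + 1)) k := by
  induction k with
  | zero => rfl
  | succ k ih =>
    rw [stateAfter, ih]
    rfl

lemma sojournTime_eq (s : TaggedState) (ω : Noise) :
    sojournTime lam μ p s ω = ENNReal.ofReal (holdingTime lam μ p (ω 0).2 s) +
      sojournTime lam μ p (nextState lam μ p (ω 0).1 s) (fun i => ω (i + 1)) := by
  unfold sojournTime
  rw [tsum_eq_zero_add' ENNReal.summable]
  simp only [stateAfter_succ_eq]
  rfl

lemma measurable_nextState (s : TaggedState) :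
    Measurable[_, ⊤] fun u => nextState lam μ p u s := by
  let _ : MeasurableSpace TaggedState := ⊤
  rcases s with _ | ⟨n, m⟩
  · exact measurable_const
  · exact Measurable.ite (measurableSet_lt measurable_subtype_coe measurable_const)
      measurable_const measurable_const

lemma measurable_holdingTime (s : TaggedState) :
    Measurable fun e => holdingTime lam μ p e s := by
  rcases s with _ | ⟨n, m⟩
  · exact measurable_const
  · exact measurable_id.div_const _

/-- The state space is countable, so with the discrete σ-algebra joint measurability reduces to
measurability in the noise for each fixed state. -/
lemma measurable_stateAfter (s : TaggedState) (k : ℕ) :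
    Measurable[_, ⊤] fun ω => stateAfter lam μ p s ω k := by
  let _ : MeasurableSpace TaggedState := ⊤
  have : MeasurableSingletonClass TaggedState := ⟨fun _ => trivial⟩
  induction k with
  | zero => exact measurable_const
  | succ k ih =>
    have h : Measurable fun x : unitInterval × TaggedState => nextState lam μ p x.1 x.2 :=
      measurable_from_prod_countable_left fun s => measurable_nextState lam μ p s
    exact h.comp ((measurable_fst.comp (measurable_pi_apply k)).prodMk ih)

lemma measurable_sojournTime (s : TaggedState) : Measurable (sojournTime lam μ p s) := by
  let _ : MeasurableSpace TaggedState := ⊤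
  have : MeasurableSingletonClass TaggedState := ⟨fun _ => trivial⟩
  refine Measurable.tsum fun k => ENNReal.measurable_ofReal.comp ?_
  have h : Measurable fun x : ℝ × TaggedState => holdingTime lam μ p x.1 x.2 :=
    measurable_from_prod_countable_left fun s => measurable_holdingTime lam μ p s
  exact h.comp ((measurable_snd.comp (measurable_pi_apply k)).prodMk
    (measurable_stateAfter lam μ p s k))

/-- The mean remaining sojourn time from an arbitrary state. -/
noncomputable def meanSojourn (s : TaggedState) : ℝ≥0∞ := ∫⁻ ω, sojournTime lam μ p s ω ∂noiseLaw

instance : IsProbabilityMeasure noiseLaw := by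
  unfold noiseLaw
  infer_instance

lemma meanSojourn_none : meanSojourn lam μ p none = 0 := by
  have h : ∀ ω k, stateAfter lam μ p none ω k = none := fun ω k => by
    induction k with
    | zero => rfl
    | succ k ih => rw [stateAfter, ih]; rfl
  simp [meanSojourn, sojournTime, h, holdingTime]

lemma meanSojourn_eq_lintegral (s : TaggedState) :
    meanSojourn lam μ p s = (∫⁻ e, ENNReal.ofReal (holdingTime lam μ p e s) ∂(expMeasure 1)) +
      ∫⁻ u, meanSojourn lam μ p (nextState lam μ p u s) := by
  let _ : MeasurableSpace TaggedState := ⊤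
  have : MeasurableSingletonClass TaggedState := ⟨fun _ => trivial⟩
  have := isProbabilityMeasure_expMeasure (r := 1) one_pos
  have hh : Measurable fun e => ENNReal.ofReal (holdingTime lam μ p e s) :=
    (measurable_holdingTime lam μ p s).ennreal_ofReal
  have hn : Measurable fun u => meanSojourn lam μ p (nextState lam μ p u s) :=
    (measurable_from_top (f := meanSojourn lam μ p)).comp (measurable_nextState lam μ p s)
  have hj : Measurable fun q : (unitInterval × ℝ) × Noise =>
      sojournTime lam μ p s (consSeq q) :=
    (measurable_sojournTime lam μ p s).comp measurable_consSeq
  have h1 : meanSojourn lam μ p s =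
      ∫⁻ x, (ENNReal.ofReal (holdingTime lam μ p x.2 s) +
        meanSojourn lam μ p (nextState lam μ p x.1 s)) ∂stepLaw := by
    -- The Markov property: the noise is its first term and an independent tail with the same law.
    conv_lhs => rw [meanSojourn, noiseLaw, ← map_consSeq_prod_infinitePi]
    rw [lintegral_map (measurable_sojournTime lam μ p s) measurable_consSeq,
      lintegral_prod _ hj.aemeasurable]
    refine lintegral_congr fun x => ?_
    have h (ω : Noise) : sojournTime lam μ p s (consSeq (x, ω)) =
        ENNReal.ofReal (holdingTime lam μ p x.2 s) +
          sojournTime lam μ p (nextState lam μ p x.1 s) ω := sojournTime_eq lam μ p s _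
    rw [lintegral_congr h, lintegral_add_left measurable_const, lintegral_const, measure_univ,
      mul_one, meanSojourn, noiseLaw]
  have h2 : ∫⁻ x, ENNReal.ofReal (holdingTime lam μ p x.2 s) ∂stepLaw =
      ∫⁻ e, ENNReal.ofReal (holdingTime lam μ p e s) ∂(expMeasure 1) :=
    (measurePreserving_snd (μ := (volume : Measure unitInterval))).lintegral_comp hh
  have h3 : ∫⁻ x, meanSojourn lam μ p (nextState lam μ p x.1 s) ∂stepLaw =
      ∫⁻ u, meanSojourn lam μ p (nextState lam μ p u s) :=
    (measurePreserving_fst (ν := expMeasure 1)).lintegral_comp hn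
  rw [h1, ← h2, ← h3]
  exact lintegral_add_left (hh.comp measurable_snd) _

/-- First-step analysis of the mean remaining sojourn time. -/
lemma meanSojourn_some {n m : ℕ} (hp : 0 ≤ lam * p m) (hμ : 0 < μ m) :
    meanSojourn lam μ p (some (n, m)) = ENNReal.ofReal (1 / (lam * p m + μ m)) +
      (ENNReal.ofReal (lam * p m / (lam * p m + μ m)) * meanSojourn lam μ p (some (n, m + 1)) +
      ENNReal.ofReal (μ m / (lam * p m + μ m)) *
        meanSojourn lam μ p (if n = 0 then none else some (n - 1, m - 1))) := by
  have hr : 0 < lam * p m + μ m := by positivity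
  set q := lam * p m / (lam * p m + μ m) with hq
  have hq0 : 0 ≤ q := by positivity
  have hq1 : q ≤ 1 := (div_le_one hr).2 (by linarith)
  have hq' : μ m / (lam * p m + μ m) = 1 - q := by rw [hq]; field_simp; ring
  rw [meanSojourn_eq_lintegral]
  congr 1
  · exact lintegral_ofReal_div_expMeasure_one hr
  · have hs : MeasurableSet (Set.Iio (⟨q, hq0, hq1⟩ : unitInterval)) := measurableSet_Iio
    rw [← lintegral_add_compl _ hs, Set.compl_Iio, hq']
    have e1 : ∫⁻ u in Set.Iio (⟨q, hq0, hq1⟩ : unitInterval),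
        meanSojourn lam μ p (nextState lam μ p u (some (n, m))) =
        ∫⁻ u in Set.Iio (⟨q, hq0, hq1⟩ : unitInterval),
          meanSojourn lam μ p (some (n, m + 1)) :=
      setLIntegral_congr_fun hs fun u hu => by
        have : (u : ℝ) < q := hu
        simp only [nextState, ← hq, if_pos this]
    have e2 : ∫⁻ u in Set.Ici (⟨q, hq0, hq1⟩ : unitInterval),
        meanSojourn lam μ p (nextState lam μ p u (some (n, m))) =
        ∫⁻ u in Set.Ici (⟨q, hq0, hq1⟩ : unitInterval),
          meanSojourn lam μ p (if n = 0 then none else some (n - 1, m - 1)) :=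
      setLIntegral_congr_fun measurableSet_Ici fun u hu => by
        have : ¬ (u : ℝ) < q := not_lt.2 hu
        simp only [nextState, ← hq, if_neg this]
    rw [e1, e2, setLIntegral_const, setLIntegral_const, unitInterval.volume_Iio,
      unitInterval.volume_Ici, mul_comm, mul_comm (meanSojourn _ _ _ _)]

end FirstStep


/-- Under a threshold strategy the chain of the tagged customer has no cycles: `m` grows up to the
threshold, or `n` decreases. -/
lemma threshold_induction {P : ℕ → ℕ → Prop} (N : ℕ)
    (h : ∀ n m, (m < N → P n (m + 1)) → (∀ k, n = k + 1 → P k (m - 1)) → P n m) (n m : ℕ) :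
    P n m := by
  induction n using Nat.strong_induction_on generalizing m with
  | _ n ihn =>
    -- For fixed `n`, `k` bounds the number of arrivals still possible before the threshold.
    suffices H : ∀ k m, N ≤ m + k → P n m from H N m (by omega)
    intro k
    induction k with
    | zero => exact fun m hm => h n m (fun _ => by omega) fun j hj => ihn j (by omega) _
    | succ k ih =>
      exact fun m hm => h n m (fun _ => ih _ (by omega)) fun j hj => ihn j (by omega) _

/-! ### Sojourn times and equilibrium under a threshold strategy -/

section Threshold

variable {lam : ℝ} {μ : ℕ → ℝ} {N : ℕ}

lemma thresholdStrategy_of_lt {m : ℕ} (h : m < N) : thresholdStrategy N m = 1 := if_pos h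

lemma thresholdStrategy_of_le {m : ℕ} (h : N ≤ m) : thresholdStrategy N m = 0 :=
  if_neg (not_lt.2 h)

lemma lam_mul_thresholdStrategy_nonneg (hlam : 0 < lam) (m : ℕ) :
    0 ≤ lam * thresholdStrategy N m := by
  unfold thresholdStrategy
  split_ifs <;> simp [hlam.le]

lemma expectedSojourn_threshold_ne_top (hlam : 0 < lam) (hμ : ∀ m, 0 < μ m) (n m : ℕ) :
    expectedSojourn lam μ (thresholdStrategy N) n m ≠ ⊤ := by
  refine threshold_induction
    (P := fun n m => expectedSojourn lam μ (thresholdStrategy N) n m ≠ ⊤) N ?_ n m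
  intro n m h1 h2
  change meanSojourn lam μ (thresholdStrategy N) (some (n, m)) ≠ ⊤
  rw [meanSojourn_some lam μ _ (lam_mul_thresholdStrategy_nonneg hlam m) (hμ m)]
  refine ENNReal.add_ne_top.2 ⟨ENNReal.ofReal_ne_top, ENNReal.add_ne_top.2 ⟨?_, ?_⟩⟩
  · rcases lt_or_ge m N with hm | hm
    · exact ENNReal.mul_ne_top ENNReal.ofReal_ne_top (h1 hm)
    · simp [thresholdStrategy_of_le hm]
  · refine ENNReal.mul_ne_top ENNReal.ofReal_ne_top ?_
    rcases n with _ | n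
    · simp [meanSojourn_none]
    · exact h2 n rfl

lemma W_nonneg (p : ℕ → ℝ) (n m : ℕ) : 0 ≤ W lam μ p n m := ENNReal.toReal_nonneg

/-- Finiteness lets the first-step identity pass to the reals, where it is cleared of the total
rate. -/
lemma W_threshold_rec (hlam : 0 < lam) (hμ : ∀ m, 0 < μ m) (n m : ℕ) :
    (lam * thresholdStrategy N m + μ m) * W lam μ (thresholdStrategy N) n m =
      1 + lam * thresholdStrategy N m * W lam μ (thresholdStrategy N) n (m + 1) +
        μ m * (if n = 0 then 0 else W lam μ (thresholdStrategy N) (n - 1) (m - 1)) := by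
  have hq := lam_mul_thresholdStrategy_nonneg (N := N) hlam m
  have hr : 0 < lam * thresholdStrategy N m + μ m := add_pos_of_nonneg_of_pos hq (hμ m)
  have hfin (k j : ℕ) : meanSojourn lam μ (thresholdStrategy N) (some (k, j)) ≠ ⊤ :=
    expectedSojourn_threshold_ne_top hlam hμ k j
  have hfin' : meanSojourn lam μ (thresholdStrategy N)
      (if n = 0 then none else some (n - 1, m - 1)) ≠ ⊤ := by
    split_ifs
    · simp [meanSojourn_none]
    · exact hfin _ _
  have hlast : (if n = 0 then 0 else W lam μ (thresholdStrategy N) (n - 1) (m - 1)) =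
      (meanSojourn lam μ (thresholdStrategy N)
        (if n = 0 then none else some (n - 1, m - 1))).toReal := by
    split_ifs
    · simp [meanSojourn_none]
    · rfl
  have key := congrArg ENNReal.toReal
    (meanSojourn_some lam μ (thresholdStrategy N) (n := n) hq (hμ m))
  rw [ENNReal.toReal_add ENNReal.ofReal_ne_top (ENNReal.add_ne_top.2
      ⟨ENNReal.mul_ne_top ENNReal.ofReal_ne_top (hfin _ _),
        ENNReal.mul_ne_top ENNReal.ofReal_ne_top hfin'⟩),
    ENNReal.toReal_add (ENNReal.mul_ne_top ENNReal.ofReal_ne_top (hfin _ _))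
      (ENNReal.mul_ne_top ENNReal.ofReal_ne_top hfin'), ENNReal.toReal_mul, ENNReal.toReal_mul,
    ENNReal.toReal_ofReal (by positivity), ENNReal.toReal_ofReal (by positivity),
    ENNReal.toReal_ofReal (div_nonneg (hμ m).le hr.le), ← hlast] at key
  change W lam μ (thresholdStrategy N) n m = _ + (_ * W lam μ (thresholdStrategy N) n (m + 1) + _)
    at key
  rw [key]
  field_simp
  ring

lemma W_threshold_zero_of_lt (hlam : 0 < lam) (hμ : ∀ m, 0 < μ m) {m : ℕ} (hm : m < N) :
    (lam + μ m) * W lam μ (thresholdStrategy N) 0 m =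
      1 + lam * W lam μ (thresholdStrategy N) 0 (m + 1) := by
  simpa [thresholdStrategy_of_lt hm] using W_threshold_rec (N := N) hlam hμ 0 m

lemma W_threshold_succ_of_lt (hlam : 0 < lam) (hμ : ∀ m, 0 < μ m) {m : ℕ} (hm : m < N) (n : ℕ) :
    (lam + μ m) * W lam μ (thresholdStrategy N) (n + 1) m =
      1 + lam * W lam μ (thresholdStrategy N) (n + 1) (m + 1) +
        μ m * W lam μ (thresholdStrategy N) n (m - 1) := by
  simpa [thresholdStrategy_of_lt hm] using W_threshold_rec (N := N) hlam hμ (n + 1) m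

lemma W_threshold_zero_of_le (hlam : 0 < lam) (hμ : ∀ m, 0 < μ m) {m : ℕ} (hm : N ≤ m) :
    μ m * W lam μ (thresholdStrategy N) 0 m = 1 := by
  simpa [thresholdStrategy_of_le hm] using W_threshold_rec (N := N) hlam hμ 0 m

lemma W_threshold_succ_of_le (hlam : 0 < lam) (hμ : ∀ m, 0 < μ m) {m : ℕ} (hm : N ≤ m) (n : ℕ) :
    μ m * W lam μ (thresholdStrategy N) (n + 1) m =
      1 + μ m * W lam μ (thresholdStrategy N) n (m - 1) := by
  simpa [thresholdStrategy_of_le hm] using W_threshold_rec (N := N) hlam hμ (n + 1) m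

/-- Under FCFS the tagged customer needs exactly `n + 1` services, each at rate at least `a`;
formally, `(n + 1) / a` is a supersolution of the recursion. -/
lemma W_threshold_le (hlam : 0 < lam) {a : ℝ} (ha : 0 < a) (hμ : ∀ m, a ≤ μ m) (n m : ℕ) :
    W lam μ (thresholdStrategy N) n m ≤ (n + 1) / a := by
  have hpos : ∀ m, 0 < μ m := fun m => ha.trans_le (hμ m)
  refine threshold_induction
    (P := fun n m => W lam μ (thresholdStrategy N) n m ≤ (n + 1) / a) N ?_ n m
  intro n m h1 h2
  have hm := hpos m
  have h3 : 1 ≤ μ m * (1 / a) := by rw [mul_one_div, one_le_div ha]; exact hμ m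
  have split (x : ℝ) : (x + 1) / a = x / a + 1 / a := add_div _ _ _
  rcases lt_or_ge m N with hN | hN <;> rcases n with _ | n
  · refine le_of_mul_le_mul_left ?_ (add_pos hlam hm)
    rw [W_threshold_zero_of_lt hlam hpos hN, split]
    have := mul_le_mul_of_nonneg_left (h1 hN) hlam.le
    rw [split] at this
    simp only [Nat.cast_zero, zero_div, zero_add] at *
    linarith
  · refine le_of_mul_le_mul_left ?_ (add_pos hlam hm)
    rw [W_threshold_succ_of_lt hlam hpos hN]
    have h4 := mul_le_mul_of_nonneg_left (h1 hN) hlam.le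
    have h5 := mul_le_mul_of_nonneg_left (h2 n rfl) hm.le
    push_cast at *
    rw [split] at h4 ⊢
    linarith
  · refine le_of_mul_le_mul_left ?_ hm
    rw [W_threshold_zero_of_le hlam hpos hN]
    simpa using h3
  · refine le_of_mul_le_mul_left ?_ hm
    rw [W_threshold_succ_of_le hlam hpos hN]
    have h5 := mul_le_mul_of_nonneg_left (h2 n rfl) hm.le
    push_cast
    rw [split]
    linarith

lemma le_W_threshold (hlam : 0 < lam) (hpos : ∀ m, 0 < μ m) {b : ℝ} (hμ : ∀ m, μ m ≤ b)
    (n m : ℕ) : (n + 1) / b ≤ W lam μ (thresholdStrategy N) n m := by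
  have hb : 0 < b := (hpos 0).trans_le (hμ 0)
  refine threshold_induction
    (P := fun n m => (n + 1) / b ≤ W lam μ (thresholdStrategy N) n m) N ?_ n m
  intro n m h1 h2
  have hm := hpos m
  have h3 : μ m * (1 / b) ≤ 1 := by rw [mul_one_div, div_le_one hb]; exact hμ m
  have split (x : ℝ) : (x + 1) / b = x / b + 1 / b := add_div _ _ _
  rcases lt_or_ge m N with hN | hN <;> rcases n with _ | n
  · refine le_of_mul_le_mul_left ?_ (add_pos hlam hm)
    rw [W_threshold_zero_of_lt hlam hpos hN, split]
    have := mul_le_mul_of_nonneg_left (h1 hN) hlam.le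
    rw [split] at this
    simp only [Nat.cast_zero, zero_div, zero_add] at *
    linarith
  · refine le_of_mul_le_mul_left ?_ (add_pos hlam hm)
    rw [W_threshold_succ_of_lt hlam hpos hN]
    have h4 := mul_le_mul_of_nonneg_left (h1 hN) hlam.le
    have h5 := mul_le_mul_of_nonneg_left (h2 n rfl) hm.le
    push_cast at *
    rw [split] at h4 ⊢
    linarith
  · refine le_of_mul_le_mul_left ?_ hm
    rw [W_threshold_zero_of_le hlam hpos hN]
    simpa using h3
  · refine le_of_mul_le_mul_left ?_ hm
    rw [W_threshold_succ_of_le hlam hpos hN]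
    have h5 := mul_le_mul_of_nonneg_left (h2 n rfl) hm.le
    push_cast
    rw [split]
    linarith

/-- While the service rate stays constant, the sojourn time is that of `n + 1` services. -/
lemma W_threshold_of_constant_rate (hlam : 0 < lam) (hpos : ∀ m, 0 < μ m) {a : ℝ} {T : ℕ}
    (hμ : ∀ m ≤ T, μ m = a) (hN : N ≤ T) (n m : ℕ) (hm : m ≤ T) :
    W lam μ (thresholdStrategy N) n m = (n + 1) / a := by
  have ha : 0 < a := hμ 0 (Nat.zero_le _) ▸ hpos 0
  refine threshold_induction
    (P := fun n m => m ≤ T → W lam μ (thresholdStrategy N) n m = (n + 1) / a) N ?_ n m hm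
  intro n m h1 h2 hm
  rcases lt_or_ge m N with hmN | hmN <;> rcases n with _ | n
  · have h := W_threshold_zero_of_lt hlam hpos hmN
    rw [h1 hmN (by omega), hμ m hm] at h
    refine mul_left_cancel₀ (add_pos hlam ha).ne' (h.trans ?_)
    field_simp
    push_cast
    ring
  · have h := W_threshold_succ_of_lt hlam hpos hmN n
    rw [h1 hmN (by omega), h2 n rfl (by omega), hμ m hm] at h
    refine mul_left_cancel₀ (add_pos hlam ha).ne' (h.trans ?_)
    field_simp
    push_cast
    ring
  · have h := W_threshold_zero_of_le hlam hpos hmN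
    rw [hμ m hm] at h
    refine mul_left_cancel₀ ha.ne' (h.trans ?_)
    field_simp
    push_cast
    ring
  · have h := W_threshold_succ_of_le hlam hpos hmN n
    rw [h2 n rfl (by omega), hμ m hm] at h
    refine mul_left_cancel₀ ha.ne' (h.trans ?_)
    field_simp
    push_cast
    ring

/-- Below the threshold, one more customer in front of the tagged one cannot shorten her sojourn,
whether that customer counts in addition or replaces one behind her. -/
lemma W_threshold_mono_aux (hlam : 0 < lam) (hpos : ∀ m, 0 < μ m) (n m : ℕ) (hnm : n + 1 ≤ m)
    (hm : m ≤ N) :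
    W lam μ (thresholdStrategy N) n m ≤ W lam μ (thresholdStrategy N) (n + 1) m ∧
      (m < N → W lam μ (thresholdStrategy N) n m ≤
        W lam μ (thresholdStrategy N) (n + 1) (m + 1)) := by
  refine threshold_induction (P := fun n m => n + 1 ≤ m → m ≤ N →
    W lam μ (thresholdStrategy N) n m ≤ W lam μ (thresholdStrategy N) (n + 1) m ∧
      (m < N → W lam μ (thresholdStrategy N) n m ≤
        W lam μ (thresholdStrategy N) (n + 1) (m + 1))) N ?_ n m hnm hm
  intro n m h1 h2 hnm hm
  have hμm := hpos m
  have hμm1 := hpos (m + 1)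
  -- `b` is the remaining time after a service: `0` if `n = 0`, else `W (n - 1) (m - 1)`. The two
  -- inductive inequalities at `(n - 1, m - 1)` give the two bounds on `b`.
  have hB : ∃ b, b ≤ W lam μ (thresholdStrategy N) n (m - 1) ∧
      b ≤ W lam μ (thresholdStrategy N) n m ∧
      (m < N → (lam + μ m) * W lam μ (thresholdStrategy N) n m =
        1 + lam * W lam μ (thresholdStrategy N) n (m + 1) + μ m * b) ∧
      (N ≤ m → μ m * W lam μ (thresholdStrategy N) n m = 1 + μ m * b) := by
    rcases n with _ | n
    · refine ⟨0, W_nonneg _ _ _, W_nonneg _ _ _, fun h => ?_, fun h => ?_⟩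
      · simpa using W_threshold_zero_of_lt hlam hpos h
      · simpa using W_threshold_zero_of_le hlam hpos h
    · have h3 := h2 n rfl (by omega) (by omega)
      refine ⟨W lam μ (thresholdStrategy N) n (m - 1), h3.1, ?_, fun h => ?_, fun h => ?_⟩
      · have := h3.2 (by omega)
        rwa [Nat.sub_add_cancel (by omega)] at this
      · exact W_threshold_succ_of_lt hlam hpos h n
      · exact W_threshold_succ_of_le hlam hpos h n
  obtain ⟨b, hb1, hb2, hblt, hble⟩ := hB
  have k1 := mul_le_mul_of_nonneg_left hb1 hμm.le
  have k2 := mul_le_mul_of_nonneg_left hb2 hμm.le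
  rcases lt_or_ge m N with hmN | hmN
  · obtain ⟨h4, h5⟩ := h1 hmN (by omega) (by omega)
    have k3 := mul_le_mul_of_nonneg_left h4 hlam.le
    refine ⟨le_of_mul_le_mul_left ?_ (add_pos hlam hμm), fun _ => ?_⟩
    · rw [hblt hmN, W_threshold_succ_of_lt hlam hpos hmN n]
      linarith
    -- A service from `(n + 1, m + 1)` leads back to `(n, m)`, so the terms with `μ (m + 1)` cancel
    -- and no monotonicity of `μ` is needed. What remains uses `lam * W n m ≤ 1 + lam * W n (m +
    -- 1)`, a consequence of `b ≤ W n m`.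
    · refine le_of_mul_le_mul_left ?_ (add_pos hlam hμm1)
      have e1 := hblt hmN
      rcases Nat.lt_or_ge (m + 1) N with hmN' | hmN'
      · have k4 := mul_le_mul_of_nonneg_left (h5 hmN') hlam.le
        have e2 := W_threshold_succ_of_lt hlam hpos hmN' n
        rw [Nat.add_sub_cancel] at e2
        linarith
      · have e2 := W_threshold_succ_of_le hlam hpos hmN' n
        rw [Nat.add_sub_cancel] at e2
        linarith
  · refine ⟨le_of_mul_le_mul_left ?_ hμm, fun h => absurd h (not_lt.2 hmN)⟩
    rw [hble hmN, W_threshold_succ_of_le hlam hpos hmN n]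
    linarith

/-- The delay of a joining customer increases with the queue she finds, below the threshold. -/
lemma delay_threshold_mono (hlam : 0 < lam) (hpos : ∀ m, 0 < μ m) {n k : ℕ} (hnk : n ≤ k)
    (hk : k < N) :
    delay lam μ (thresholdStrategy N) n ≤ delay lam μ (thresholdStrategy N) k := by
  induction k, hnk using Nat.le_induction with
  | base => exact le_rfl
  | succ k _ ih =>
    exact (ih (by omega)).trans
      ((W_threshold_mono_aux hlam hpos k (k + 1) le_rfl (by omega)).2 hk)

/-- A customer who joins at the threshold first waits for one service without arrivals. -/
lemma delay_threshold_self_succ (hlam : 0 < lam) (hpos : ∀ m, 0 < μ m) (k : ℕ) :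
    delay lam μ (thresholdStrategy (k + 1)) (k + 1) =
      1 / μ (k + 2) + W lam μ (thresholdStrategy (k + 1)) k (k + 1) := by
  have h := W_threshold_succ_of_le hlam hpos (N := k + 1) (m := k + 2) (by omega) k
  have := hpos (k + 2)
  refine mul_left_cancel₀ this.ne' (h.trans ?_)
  field_simp
  rfl

lemma thresholdStrategy_mem_strategies (N : ℕ) : thresholdStrategy N ∈ strategies := by
  intro n
  unfold thresholdStrategy
  split_ifs <;> norm_num

/-- A threshold strategy is an equilibrium if and only if joining is worthwhile below the
threshold and not strictly worthwhile at the threshold. -/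
lemma isEquilibrium_threshold_iff {R C : ℝ} (hC : 0 < C) :
    IsEquilibrium R C lam μ (thresholdStrategy N) ↔
      (∀ n < N, delay lam μ (thresholdStrategy N) n ≤ R / C) ∧
        R / C ≤ delay lam μ (thresholdStrategy N) N := by
  have hleast : IsLeast {n | thresholdStrategy N n = 0} N := by
    refine ⟨thresholdStrategy_of_le le_rfl, fun n hn => ?_⟩
    by_contra h
    have h0 : thresholdStrategy N n = 0 := hn
    simp [thresholdStrategy_of_lt (not_le.1 h)] at h0
  constructor
  · rintro ⟨_, n₀, hn₀, h⟩
    obtain rfl := hn₀.unique hleast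
    refine ⟨fun n hn => ?_, ?_⟩
    -- The test deviations are never joining (below the threshold) and always joining (at it).
    · have := h n hn.le (fun _ => 0) fun _ => by norm_num
      simp only [netBenefit, thresholdStrategy_of_lt hn, zero_mul, one_mul] at this
      rw [le_div_iff₀ hC]
      linarith
    · have := h n₀ le_rfl (fun _ => 1) fun _ => by norm_num
      simp only [netBenefit, thresholdStrategy_of_le le_rfl, zero_mul, one_mul] at this
      rw [div_le_iff₀ hC]
      linarith
  · rintro ⟨h1, h2⟩
    refine ⟨thresholdStrategy_mem_strategies N, N, hleast, fun n hn q hq => ?_⟩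
    rcases hn.lt_or_eq with hn | rfl
    · have := h1 n hn
      rw [le_div_iff₀ hC] at this
      simp only [netBenefit, thresholdStrategy_of_lt hn]
      exact mul_le_mul_of_nonneg_right (hq n).2 (by linarith)
    · rw [div_le_iff₀ hC] at h2
      simp only [netBenefit, thresholdStrategy_of_le le_rfl, zero_mul]
      exact mul_nonpos_of_nonneg_of_nonpos (hq n).1 (by linarith)

end Threshold

/-! ### Equilibrium thresholds for two service rates -/

section TwoRate

variable {lam μl μh : ℝ} {T : ℕ}

lemma twoRate_pos (hμl : 0 < μl) (hμ : μl < μh) (m : ℕ) : 0 < twoRate T μl μh m := by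
  unfold twoRate
  split_ifs
  exacts [hμl, hμl.trans hμ]

lemma le_twoRate (hμ : μl < μh) (m : ℕ) : μl ≤ twoRate T μl μh m := by
  unfold twoRate
  split_ifs
  exacts [le_rfl, hμ.le]

lemma twoRate_le (hμ : μl < μh) (m : ℕ) : twoRate T μl μh m ≤ μh := by
  unfold twoRate
  split_ifs
  exacts [hμ.le, le_rfl]

/-- Equilibrium thresholds `N ≤ T`, in terms of the normalized reward `R / C * μl`. -/
lemma mem_lowEquilibria_iff {R C : ℝ} (hR : 0 ≤ R) (hC : 0 < C) (hlam : 0 < lam) (hμl : 0 < μl)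
    (hμ : μl < μh) (hT : 1 ≤ T) (N : ℕ) :
    N ∈ lowEquilibria R C lam (twoRate T μl μh) T ↔
      (N < T ∧ (N : ℝ) ≤ R / C * μl ∧ R / C * μl ≤ N + 1) ∨
        (N = T ∧ (T : ℝ) ≤ R / C * μl ∧ R / C * μl ≤ T + μl / μh) := by
  have hpos : ∀ m, 0 < twoRate T μl μh m := twoRate_pos hμl hμ
  have hμh := hμl.trans hμ
  have hlow : ∀ m ≤ T, twoRate T μl μh m = μl := fun m hm => if_pos hm
  have hRC : 0 ≤ R / C := by positivity
  have hjoin (hN : N ≤ T) : (∀ n < N, delay lam (twoRate T μl μh) (thresholdStrategy N) n ≤ R / C)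
      ↔ (N : ℝ) ≤ R / C * μl := by
    have hd : ∀ n < N, delay lam (twoRate T μl μh) (thresholdStrategy N) n = (n + 1) / μl :=
      fun n hn => W_threshold_of_constant_rate hlam hpos hlow hN n (n + 1) (by omega)
    constructor
    · intro h
      rcases N with _ | k
      -- For threshold `0` the joining condition is vacuous, and the right side holds because `R ≥
      -- 0`.
      · simpa using mul_nonneg hRC hμl.le
      · have := h k (by omega)
        rw [hd k (by omega), div_le_iff₀ hμl] at this
        exact_mod_cast this
    · intro h n hn
      rw [hd n hn, div_le_iff₀ hμl]
      have : (n : ℝ) + 1 ≤ N := by exact_mod_cast hn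
      exact this.trans h
  change N ≤ T ∧ IsEquilibrium R C lam (twoRate T μl μh) (thresholdStrategy N) ↔ _
  rw [isEquilibrium_threshold_iff hC]
  rcases lt_trichotomy N T with hN | rfl | hN
  · have hd : delay lam (twoRate T μl μh) (thresholdStrategy N) N = (N + 1) / μl :=
      W_threshold_of_constant_rate hlam hpos hlow hN.le N (N + 1) (by omega)
    rw [hjoin hN.le, hd, le_div_iff₀ hμl]
    simp [hN, hN.le, hN.ne]
  · obtain ⟨k, rfl⟩ : ∃ k, N = k + 1 := ⟨N - 1, by omega⟩
    have hd : delay lam (twoRate (k + 1) μl μh) (thresholdStrategy (k + 1)) (k + 1) =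
        1 / μh + ((k + 1 : ℕ) : ℝ) / μl := by
      rw [delay_threshold_self_succ hlam hpos,
        W_threshold_of_constant_rate hlam hpos hlow le_rfl k (k + 1) le_rfl]
      simp [twoRate]
    have hiff : R / C ≤ 1 / μh + ((k + 1 : ℕ) : ℝ) / μl ↔
        R / C * μl ≤ ((k + 1 : ℕ) : ℝ) + μl / μh := by
      rw [← mul_le_mul_iff_left₀ hμl]
      have : (1 / μh + ((k + 1 : ℕ) : ℝ) / μl) * μl = ((k + 1 : ℕ) : ℝ) + μl / μh := by
        field_simp
        ring
      rw [this]
    rw [hjoin le_rfl, hd, hiff]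
    simp
  · simp [hN.not_ge, hN.not_gt, hN.ne']

/-- Monotone delays leave only state `N - 1` to check for joining. At `N` the first service has rate
`μh` since `N + 1 > T`, which turns the balking condition into the lower bound on `W`. -/
lemma isEquilibrium_threshold_iff_of_lt {R C : ℝ} (hC : 0 < C) (hlam : 0 < lam) (hμl : 0 < μl)
    (hμ : μl < μh) {N : ℕ} (hN : T + 1 ≤ N) :
    IsEquilibrium R C lam (twoRate T μl μh) (thresholdStrategy N) ↔
      R / C - 1 / μh ≤ W lam (twoRate T μl μh) (thresholdStrategy N) (N - 1) N ∧
        W lam (twoRate T μl μh) (thresholdStrategy N) (N - 1) N ≤ R / C := by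
  have hpos : ∀ m, 0 < twoRate T μl μh m := twoRate_pos hμl hμ
  obtain ⟨k, rfl⟩ : ∃ k, N = k + 1 := ⟨N - 1, by omega⟩
  have hrate : twoRate T μl μh (k + 2) = μh := if_neg (by omega)
  rw [isEquilibrium_threshold_iff hC, delay_threshold_self_succ hlam hpos, hrate,
    Nat.add_sub_cancel]
  constructor
  · exact fun ⟨h1, h2⟩ => ⟨by linarith, h1 k (by omega)⟩
  · exact fun ⟨h1, h2⟩ => ⟨fun n hn =>
      (delay_threshold_mono hlam hpos (by omega) (Nat.lt_succ_self k)).trans h2, by linarith⟩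

end TwoRate

end ObservableQueue

open ObservableQueue
-- The theorem
theorem theorem3 (R C lam μl μh : ℝ) (T : ℕ) (hR : 0 ≤ R) (hC : 0 < C) (hlam : 0 < lam)
    (hμl : 0 < μl) (hμ : μl < μh) (hT : 1 ≤ T) :
    -- the expected sojourn times in the equilibrium conditions are finite
    (∀ n₀ n : ℕ, n ≤ n₀ →
      expectedSojourn lam (twoRate T μl μh) (thresholdStrategy n₀) n (n + 1) ≠ ⊤) ∧
    -- (i) thresholds in `{0, 1, …, T}`
    (lowEquilibria R C lam (twoRate T μl μh) T).encard ≤ 2 ∧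
    (R / C * μl ≤ T → (∃ z : ℤ, R / C * μl = z) → 0 < R →
      ∃ n₁ n₂ : ℕ, n₁ ≠ n₂ ∧ (n₁ : ℝ) = R / C * μl - 1 ∧ (n₂ : ℝ) = R / C * μl ∧
        lowEquilibria R C lam (twoRate T μl μh) T = {n₁, n₂}) ∧
    (R = 0 → lowEquilibria R C lam (twoRate T μl μh) T = {0}) ∧
    (R / C * μl < T → (¬ ∃ z : ℤ, R / C * μl = z) →
      lowEquilibria R C lam (twoRate T μl μh) T = {⌊R / C * μl⌋₊}) ∧
    (T < R / C * μl → R / C * μl ≤ T + μl / μh →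
      T = ⌊R / C * μl⌋₊ ∧ lowEquilibria R C lam (twoRate T μl μh) T = {T}) ∧
    (T + μl / μh < R / C * μl → lowEquilibria R C lam (twoRate T μl μh) T = ∅) ∧
    -- (ii) thresholds in `{T + 1, T + 2, …}`
    (∀ n₀ : ℕ, T + 1 ≤ n₀ →
      (IsEquilibrium R C lam (twoRate T μl μh) (thresholdStrategy n₀) ↔
        (max ((R / C - 1 / μh) * μl) (T + 1) ≤ n₀ ∧ n₀ ≤ max (R / C * μh) (T + 1)) ∧
        R / C - 1 / μh ≤ W lam (twoRate T μl μh) (thresholdStrategy n₀) (n₀ - 1) n₀ ∧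
        W lam (twoRate T μl μh) (thresholdStrategy n₀) (n₀ - 1) n₀ ≤ R / C)) := by
  have hμh := hμl.trans hμ
  have hμh' : 0 < μl / μh := by positivity
  have hμh1 : μl / μh < 1 := (div_lt_one hμh).2 hμ
  have hpos : ∀ m, 0 < twoRate T μl μh m := twoRate_pos hμl hμ
  have hmem := mem_lowEquilibria_iff hR hC hlam hμl hμ hT
  have hx : 0 ≤ R / C * μl := by positivity
  set x := R / C * μl with hxdef
  -- Since `μl / μh < 1`, the sharper condition at `N = T` implies the generic one.
  have hbounds : ∀ N ∈ lowEquilibria R C lam (twoRate T μl μh) T, (N : ℝ) ≤ x ∧ x ≤ N + 1 := by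
    intro N hN
    rcases (hmem N).1 hN with ⟨_, h1, h2⟩ | ⟨rfl, h1, h2⟩
    · exact ⟨h1, h2⟩
    · exact ⟨h1, by linarith⟩
  refine ⟨fun n₀ n _ => expectedSojourn_threshold_ne_top hlam hpos n (n + 1), ?_, ?_, ?_, ?_, ?_,
    ?_, ?_⟩
  · have hsub : lowEquilibria R C lam (twoRate T μl μh) T ⊆ {⌊x⌋₊ - 1, ⌊x⌋₊} := by
      intro N hN
      obtain ⟨h1, h2⟩ := hbounds N hN
      have h3 : N ≤ ⌊x⌋₊ := Nat.le_floor h1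
      have h4 : ⌊x⌋₊ ≤ N + 1 := by
        have := (Nat.floor_le hx).trans h2
        exact_mod_cast this
      simp only [Set.mem_insert_iff, Set.mem_singleton_iff]
      omega
    refine (Set.encard_le_encard hsub).trans ((Set.encard_insert_le _ _).trans ?_)
    rw [Set.encard_singleton, one_add_one_eq_two]
  · rintro hxT ⟨z, hz⟩ hRpos
    have hxpos : 0 < x := by positivity
    obtain ⟨k, rfl⟩ : ∃ k : ℕ, z = k + 1 := by
      have : 0 < z := by rw [hz] at hxpos; exact_mod_cast hxpos
      exact ⟨(z - 1).toNat, by omega⟩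
    have hxk : x = k + 1 := by rw [hz]; push_cast; ring
    have hkT : k + 1 ≤ T := by rw [hxk] at hxT; exact_mod_cast hxT
    refine ⟨k, k + 1, by omega, by linarith, by push_cast; linarith, Set.ext fun N => ?_⟩
    simp only [Set.mem_insert_iff, Set.mem_singleton_iff]
    constructor
    · intro hN
      obtain ⟨h1, h2⟩ := hbounds N hN
      rw [hxk] at h1 h2
      have h3 : N ≤ k + 1 := by exact_mod_cast h1
      have h4 : k + 1 ≤ N + 1 := by exact_mod_cast h2
      omega
    · rw [hmem, hxk]
      rintro (rfl | rfl)
      · exact Or.inl ⟨by omega, by linarith, le_rfl⟩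
      · rcases hkT.lt_or_eq with h | rfl
        · exact Or.inl ⟨h, by push_cast; exact le_rfl, by push_cast; linarith⟩
        · exact Or.inr ⟨rfl, by push_cast; exact le_rfl, by push_cast; linarith⟩
  · rintro rfl
    have hx0 : x = 0 := by simp [hxdef]
    ext N
    rw [Set.mem_singleton_iff]
    constructor
    · intro hN
      have h1 := (hbounds N hN).1
      rw [hx0] at h1
      have h2 : N ≤ 0 := by exact_mod_cast h1
      omega
    · rintro rfl
      rw [hmem, hx0]
      exact Or.inl ⟨by omega, by simp, by simp⟩
  · intro hxT hxz
    have hfT : ⌊x⌋₊ < T := (Nat.floor_lt hx).2 hxT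
    ext N
    rw [Set.mem_singleton_iff]
    constructor
    · intro hN
      obtain ⟨h1, h2⟩ := hbounds N hN
      refine ((Nat.floor_eq_iff hx).2 ⟨h1, h2.lt_of_ne fun h => hxz ⟨N + 1, ?_⟩⟩).symm
      rw [h]
      push_cast
      rfl
    · rintro rfl
      exact (hmem _).2 (Or.inl ⟨hfT, Nat.floor_le hx, (Nat.lt_floor_add_one x).le⟩)
  · intro hTx hxT
    refine ⟨((Nat.floor_eq_iff hx).2 ⟨hTx.le, by linarith⟩).symm, Set.ext fun N => ?_⟩
    rw [Set.mem_singleton_iff]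
    constructor
    · intro hN
      rcases (hmem N).1 hN with ⟨h, _, h2⟩ | ⟨h, _⟩
      · have : (N : ℝ) + 1 ≤ T := by exact_mod_cast h
        linarith
      · exact h
    · rintro rfl
      exact (hmem N).2 (Or.inr ⟨rfl, hTx.le, hxT⟩)
  · intro hTx
    refine Set.eq_empty_of_forall_notMem fun N hN => ?_
    rcases (hmem N).1 hN with ⟨h, _, h2⟩ | ⟨_, _, h2⟩
    · have : (N : ℝ) + 1 ≤ T := by exact_mod_cast h
      linarith
    · linarith
  · intro n₀ hn₀
    rw [isEquilibrium_threshold_iff_of_lt hC hlam hμl hμ hn₀]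
    -- The bounds on `n₀` are implied by those on `W`, so only this direction needs work.
    refine ⟨fun h => ⟨?_, h⟩, fun h => h.2⟩
    have hcast : ((n₀ - 1 : ℕ) : ℝ) + 1 = n₀ := by
      rw [Nat.cast_sub (by omega)]
      simp
    have hn₀' : (T : ℝ) + 1 ≤ n₀ := by exact_mod_cast hn₀
    have hle := W_threshold_le (N := n₀) hlam hμl (le_twoRate (T := T) hμ) (n₀ - 1) n₀
    have hge := le_W_threshold (N := n₀) hlam hpos (twoRate_le (T := T) hμ) (n₀ - 1) n₀
    rw [hcast] at hle hge
    refine ⟨max_le ?_ hn₀', le_max_of_le_left ?_⟩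
    · exact (le_div_iff₀ hμl).1 (h.1.trans hle)
    · exact (div_le_iff₀ hμh).1 (hge.trans h.2)
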